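/- Let $q\ge 2$ be an integer and let $n=4+2q$. Put $m_0=n^2+3n+1$, $m_1=m_0+1$, $m_2=m_0+2$, $m_3=m_0+n+2$, $m_4=m_0+n+3$, let $\Gamma=\mathfrak S_{(n,5)}=\langle m_0,m_1,m_2,m_3,m_4\rangle\subset\mathbb N$, and let $\mathrm{Ap}=\mathrm{Ap}(\Gamma,m_0)=\{s\in\Gamma\mid s-m_0\notin\Gamma\}$. The *length* of an expression $x=\sum_{i=0}^4 c_im_i$ with $c_i\in\mathbb N$ is $\sum c_i$, and $\mathrm{ord}(x)$ is the largest length of an expression of $x$. Put $M=\Gamma\setminus\{0\}$, $0M=\Gamma$, and $sM=M+\cdots+M$ ($s$ copies) for $s\ge1$. The reduction number is $r=\min\{r\mid (r+1)M=m_0+rM\}$. The Apéry table of $\Gamma$ with respect to $m_0$ is the $(r+1)\times m_0$ matrix with one column for each $w\in \mathrm{Ap}$, whose entries $\omega_0,\dots,\omega_r$ are: $\omega_0=w$; $\omega_1=w$ if $w\ne0$ and $\omega_1=m_0$ if $w=0$; and, for $s\ge1$, $\omega_{s+1}=\omega_s$ if $\omega_s\in(s+1)M$ and $\omega_{s+1}=\omega_s+m_0$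 otherwise. Then the following hold. 1. $\mathrm{Ap}$ is homogeneous: for every nonzero $x\in\mathrm{Ap}$, all expressions of $x$ have the same length. 2. For every $k\ge1$: - $\mathrm{ord}(m_1+km_0)=k+1$; - $\mathrm{ord}(tm_2+km_0)=t+k$ for $1\le t\le n/2$; - $\mathrm{ord}(tm_i+km_0)=t+k$ for $1\le t\le n$ and $i=3,4$; - $\mathrm{ord}(m_i+tm_3+km_0)=\mathrm{ord}(m_i+tm_2+km_0)=t+k+1$ for $1\le t\le n/2$ and $i=1,3$; - $\mathrm{ord}(tm_2+sm_3+km_0)=\mathrm{ord}(tm_3+sm_4+km_0)=t+s+k$ for $1\le t\le n-1$ and $1\le s\le n-t$; - $\mathrm{ord}(w+km_0)=\mathrm{ord}(w)+k$ for all $w\in\mathrm{Ap}$. 3. The reduction number of $\Gamma$ is $n$, and the Apéry table of $\Gamma$ with respect to $m_0$ is the $(n+1)\times m_0$ matrix $(\mathcal B_1\ \mathcal B_2\ \cdots\ \mathcal B_{11})$. Its blocks have the following entries in row $i$, $1\le i\le n+1$, and column $j$. Here $x^+=\max(x,0)$, and blocks 7–11 are juxtapositions of sub-blocks indexed by $s$.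 - $\mathcal B_1$ ($2$ columns): $(i-1)m_0$ for $j=1$; $m_1+(i-2)^+m_0$ for $j=2$. - $\mathcal B_2$ ($1\le j\le n/2$): $jm_2+(i-j-1)^+m_0$. - $\mathcal B_3$, $\mathcal B_4$ ($1\le j\le n$): $jm_3+(i-j-1)^+m_0$ and $jm_4+(i-j-1)^+m_0$ respectively. - $\mathcal B_5$, $\mathcal B_6$ ($1\le j\le n/2$): $m_1+jm_2+(i-j-2)^+m_0$ and $m_3+jm_2+(i-j-2)^+m_0$ respectively. - $\mathcal B_7$ ($1\le s\le n/2-1$, $1\le j\le n/2-s$): $2sm_4+jm_2+(i-j-2s-1)^+m_0$. - $\mathcal B_8$ ($1\le s\le n/2$, $1\le j\le n/2+1-s$): $(2s-1)m_4+jm_2+(i-j-2s)^+m_0$. - $\mathcal B_9$ ($1\le s\le n-1$, $1\le j\le n-s$): $(n-s-j+1)m_4+jm_3+(i+s-n-2)^+m_0$. - $\mathcal B_{10}$ ($1\le s\le n/2-1$, $1\le j\le n/2-s$): $2sm_4+jm_2+m_3+(i-j-2s-2)^+m_0$. - $\mathcal B_{11}$ ($1\le s\le n/2-1$, $1\le j\le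 n/2+1-s$): $(2s-1)m_4+jm_2+m_3+(i-j-2s-1)^+m_0$. 4. For $1\le k\le n$, the number of elements of order $k$ in $\mathrm{Ap}$ is $3k+1$ if $k\le n/2$, and $2n+4-k$ if $n/2<k\le n$. -/

import Mathlib

namespace ConcatSemigroup

/-! ### Factorizations, lengths and orders -/

/-- The semigroup generated by the family `m`. -/
def semigroup {e : ℕ} (m : Fin e → ℕ) : AddSubmonoid ℕ :=
  AddSubmonoid.closure (Set.range m)

/-- The set `F(x)` of factorizations of `x` with respect to the generators `m`. -/
def factorizations {e : ℕ} (m : Fin e → ℕ) (x : ℕ) : Set (Fin e → ℕ) :=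
  {c | ∑ i, c i * m i = x}

/-- The set `L(x)` of lengths (total orders) of the factorizations of `x`. -/
def lengthSet {e : ℕ} (m : Fin e → ℕ) (x : ℕ) : Set ℕ :=
  (fun c : Fin e → ℕ => ∑ i, c i) '' factorizations m x

/-- The order of `x`: the largest length of a factorization of `x`. -/
noncomputable def ord {e : ℕ} (m : Fin e → ℕ) (x : ℕ) : ℕ :=
  sSup (lengthSet m x)

/-- For positive generators the supremum in `ord` is an attained maximum as soon as `x` has a
factorization. -/
theorem isGreatest_ord {e : ℕ} (m : Fin e → ℕ) (hm : ∀ i, 0 < m i) (x : ℕ)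
    (hx : (factorizations m x).Nonempty) : IsGreatest (lengthSet m x) (ord m x) := by
  have hb : BddAbove (lengthSet m x) := by
    refine ⟨x, ?_⟩
    rintro _ ⟨c, hc, rfl⟩
    have hc' : ∑ i, c i * m i = x := hc
    rw [← hc']
    exact Finset.sum_le_sum fun i _ => Nat.le_mul_of_pos_right _ (hm i)
  exact ⟨Nat.sSup_mem (hx.image _) hb, fun y hy => le_csSup hb hy⟩

/-- `T` is homogeneous: every nonzero element of `T` has exactly one factorization length. -/
def IsHomogeneous {e : ℕ} (m : Fin e → ℕ) (T : Set ℕ) : Prop :=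
  ∀ x ∈ T, x ≠ 0 → ∃ l, lengthSet m x = {l}

/-! ### Apéry sets and Apéry tables -/

/-- `Ap(Γ, a) = {s ∈ Γ | s - a ∉ Γ}`, the difference being taken in the integers. -/
def aperySet (Γ : AddSubmonoid ℕ) (a : ℕ) : Set ℕ :=
  {s | s ∈ Γ ∧ ¬ ∃ t ∈ Γ, t + a = s}

/-- `nM = M + ⋯ + M` (`n` copies), where `M = Γ \ {0}`; by convention `0M = Γ`, as for the powers
of the maximal ideal of the semigroup ring. -/
def nfold (Γ : AddSubmonoid ℕ) : ℕ → Set ℕ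
  | 0 => {z | z ∈ Γ}
  | n + 1 => {z | ∃ x ∈ nfold Γ n, ∃ y ∈ Γ, y ≠ 0 ∧ x + y = z}

/-- The reduction number `min {r | (r + 1)M = a + rM}`. -/
noncomputable def reductionNumber (Γ : AddSubmonoid ℕ) (a : ℕ) : ℕ :=
  sInf {r | nfold Γ (r + 1) = (fun x => a + x) '' nfold Γ r}

open Classical in
/-- The entry in row `s` of the column of the Apéry table that starts with `w ∈ Ap(Γ, a)`:
row `0` is `w`, row `1` is `w` (or `a` when `w = 0`), and each further row repeats the
previous entry when that entry lies in `(s + 1)M` and adds `a` to it otherwise. -/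
noncomputable def aperyEntry (Γ : AddSubmonoid ℕ) (a w : ℕ) : ℕ → ℕ
  | 0 => w
  | 1 => if w = 0 then a else w
  | s + 2 =>
      if aperyEntry Γ a w (s + 1) ∈ nfold Γ (s + 2) then aperyEntry Γ a w (s + 1)
      else aperyEntry Γ a w (s + 1) + a

/-- `T` is the Apéry table of `Γ` with respect to `a`, with columns labelled by `ι`: it has
size `(r + 1) × a` with `r` the reduction number, and its columns are the columns that start with
the elements of `Ap(Γ, a)`, each element occurring once. -/
def IsAperyTable (Γ : AddSubmonoid ℕ) (a : ℕ) {R : ℕ} {ι : Type} [Fintype ι]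
    (T : Matrix (Fin R) ι ℕ) : Prop :=
  R = reductionNumber Γ a + 1 ∧ Fintype.card ι = a ∧
    ∃ ω : ι → ℕ, Function.Injective ω ∧ Set.range ω = aperySet Γ a ∧
      ∀ (i : Fin R) (j : ι), T i j = aperyEntry Γ a (ω j) i

/-! ### The semigroups `𝔖_(n,e,p)` and `𝔖_(n,5)` -/

/-- The generators `m_0, …, m_(e-1)` of `𝔖_(n,e,p)`:
`m_i = n² + (e-2)n + p + i` for `0 ≤ i ≤ e-3`, `m_(e-2) = n² + (e-1)n + p + (e-3)` and
`m_(e-1) = n² + (e-1)n + p + (e-2)`. -/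
def gen (n e p : ℕ) (i : Fin e) : ℕ :=
  if (i : ℕ) ≤ e - 3 then n ^ 2 + (e - 2) * n + p + i
  else n ^ 2 + (e - 1) * n + p + (i - 1)

/-- The generators `m_0, …, m_4` of `𝔖_(n,5) = 𝔖_(n,5,1)` (the case `e = 5`, `p = e - 4`). -/
def gen5 (n : ℕ) : Fin 5 → ℕ := gen n 5 (5 - 4)

/-- The semigroup `𝔖_(n,5)`. -/
def S5 (n : ℕ) : AddSubmonoid ℕ := semigroup (gen5 n)

theorem gen5_eq (n : ℕ) : gen5 n = ![n ^ 2 + 3 * n + 1, n ^ 2 + 3 * n + 2, n ^ 2 + 3 * n + 3,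
    n ^ 2 + 4 * n + 3, n ^ 2 + 4 * n + 4] := by
  funext i
  fin_cases i <;> simp [gen5, gen]

/-- For `n ≥ 2` the integers `m_0, …, m_4` are strictly increasing and none of them is a
combination of the others, so they are the minimal generators of `𝔖_(n,5)`, and
`factorizations`, `lengthSet` and `ord` for the family `gen5 n` are the usual notions
for that semigroup. -/
theorem gen5_minimal (n : ℕ) (hn : 2 ≤ n) : StrictMono (gen5 n) ∧
    ∀ i, ∀ c ∈ factorizations (gen5 n) (gen5 n i), c i ≠ 0 := by
  rw [gen5_eq]
  refine ⟨?_, ?_⟩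
  · rw [Fin.strictMono_iff_lt_succ]
    intro i
    fin_cases i <;> simp <;> omega
  · intro i c hc h0
    have hc' : c 0 * (n ^ 2 + 3 * n + 1) + c 1 * (n ^ 2 + 3 * n + 2) + c 2 * (n ^ 2 + 3 * n + 3)
        + c 3 * (n ^ 2 + 4 * n + 3) + c 4 * (n ^ 2 + 4 * n + 4)
        = ![n ^ 2 + 3 * n + 1, n ^ 2 + 3 * n + 2, n ^ 2 + 3 * n + 3,
            n ^ 2 + 4 * n + 3, n ^ 2 + 4 * n + 4] i := by
      simpa [factorizations, Fin.sum_univ_five] using hc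
    have hi : ![n ^ 2 + 3 * n + 1, n ^ 2 + 3 * n + 2, n ^ 2 + 3 * n + 3,
            n ^ 2 + 4 * n + 3, n ^ 2 + 4 * n + 4] i ≤ n ^ 2 + 4 * n + 4 := by
      fin_cases i <;> simp <;> omega
    have hs : c 0 + c 1 + c 2 + c 3 + c 4 < 2 := by
      by_contra hge
      push Not at hge
      have : 2 * (n ^ 2 + 3 * n + 1) ≤
          (c 0 + c 1 + c 2 + c 3 + c 4) * (n ^ 2 + 3 * n + 1) := Nat.mul_le_mul_right _ hge
      nlinarith
    have h01 : ∀ j, c j = 0 ∨ c j = 1 := by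
      intro j
      fin_cases j <;> simp <;> omega
    fin_cases i <;> simp at hc' h0 <;>
      rcases h01 0 with a0 | a0 <;> rcases h01 1 with a1 | a1 <;> rcases h01 2 with a2 | a2 <;>
      rcases h01 3 with a3 | a3 <;> rcases h01 4 with a4 | a4 <;>
      simp only [a0, a1, a2, a3, a4] at hc' hs h0 <;> omega

/-! ### The blocks of the table

In the entry functions `b₁, …, b₁₁` the indices `i`, `j`, `s` start at `1`. -/

def b1 (n i j : ℕ) : ℕ :=
  if j = 1 then (i - 1) * gen5 n 0
  else if i ≤ 2 then gen5 n 1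
  else gen5 n 1 + (i - 2) * gen5 n 0

def b2 (n i j : ℕ) : ℕ :=
  j * gen5 n 2 + (if i > j + 1 then i - j - 1 else 0) * gen5 n 0

def b3 (n i j : ℕ) : ℕ :=
  j * gen5 n 3 + (if i > j + 1 then i - j - 1 else 0) * gen5 n 0

def b4 (n i j : ℕ) : ℕ :=
  j * gen5 n 4 + (if i > j + 1 then i - j - 1 else 0) * gen5 n 0

def b5 (n i j : ℕ) : ℕ :=
  gen5 n 1 + j * gen5 n 2 + (if i > j + 2 then i - j - 2 else 0) * gen5 n 0

def b6 (n i j : ℕ) : ℕ :=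
  gen5 n 3 + j * gen5 n 2 + (if i > j + 2 then i - j - 2 else 0) * gen5 n 0

def b7 (n s i j : ℕ) : ℕ :=
  2 * s * gen5 n 4 + j * gen5 n 2 +
    (if i > j + 2 * s + 1 then i - j - 2 * s - 1 else 0) * gen5 n 0

def b8 (n s i j : ℕ) : ℕ :=
  (2 * s - 1) * gen5 n 4 + j * gen5 n 2 +
    (if i > j + 2 * s then i - j - 2 * s else 0) * gen5 n 0

def b9 (n s i j : ℕ) : ℕ :=
  (n - s - j + 1) * gen5 n 4 + j * gen5 n 3 +
    (if i + s > n + 2 then i + s - n - 2 else 0) * gen5 n 0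

def b10 (n s i j : ℕ) : ℕ :=
  2 * s * gen5 n 4 + j * gen5 n 2 + gen5 n 3 +
    (if i > j + 2 * s + 2 then i - j - 2 * s - 2 else 0) * gen5 n 0

def b11 (n s i j : ℕ) : ℕ :=
  (2 * s - 1) * gen5 n 4 + j * gen5 n 2 + gen5 n 3 +
    (if i > j + 2 * s + 1 then i - j - 2 * s - 1 else 0) * gen5 n 0

/-- The `(n + 1) × c` matrix with entries `f i j`, `1 ≤ i ≤ n + 1`, `1 ≤ j ≤ c`. -/
def block (n c : ℕ) (f : ℕ → ℕ → ℕ) : Matrix (Fin (n + 1)) (Fin c) ℕ :=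
  Matrix.of fun i j => f (i + 1) (j + 1)

/-- The juxtaposition `(Q_1 ⋯ Q_N)`, where `Q_s` is the `(n + 1) × c s` matrix with entries
`f s i j`, `1 ≤ i ≤ n + 1`, `1 ≤ j ≤ c s`. -/
def blocks (n N : ℕ) (c : ℕ → ℕ) (f : ℕ → ℕ → ℕ → ℕ) :
    Matrix (Fin (n + 1)) (Σ s : Fin N, Fin (c (s + 1))) ℕ :=
  Matrix.of fun i x => block n (c (x.1 + 1)) (f (x.1 + 1)) i x.2

def B1 (n : ℕ) := block n 2 (b1 n)
def B2 (n : ℕ) := block n (n / 2) (b2 n)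
def B3 (n : ℕ) := block n n (b3 n)
def B4 (n : ℕ) := block n n (b4 n)
def B5 (n : ℕ) := block n (n / 2) (b5 n)
def B6 (n : ℕ) := block n (n / 2) (b6 n)
def B7 (n : ℕ) := blocks n (n / 2 - 1) (fun s => n / 2 - s) (b7 n)
def B8 (n : ℕ) := blocks n (n / 2) (fun s => n / 2 + 1 - s) (b8 n)
def B9 (n : ℕ) := blocks n (n - 1) (fun s => n - s) (b9 n)
def B10 (n : ℕ) := blocks n (n / 2 - 1) (fun s => n / 2 - s) (b10 n)
def B11 (n : ℕ) := blocks n (n / 2 - 1) (fun s => n / 2 + 1 - s) (b11 n)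

/-- The matrix `(B_1 B_2 ⋯ B_11)`. -/
def table5 (n : ℕ) :=
  (B1 n).fromCols <| (B2 n).fromCols <| (B3 n).fromCols <| (B4 n).fromCols <|
  (B5 n).fromCols <| (B6 n).fromCols <| (B7 n).fromCols <| (B8 n).fromCols <|
  (B9 n).fromCols <| (B10 n).fromCols (B11 n)

end ConcatSemigroup

open ConcatSemigroup

namespace ConcatSemigroup

/-! The generators are `m_0 + e` with `e ∈ {0, 1, 2, n + 2, n + 3}`, and `n (n + 3) = m_0 - 1`.
Hence a factorization of length `l ≤ n` has total excess below `m_0`: its length is the quotient of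
`x` by `m_0`, and its excess is the residue. The theorem thus reduces to division by `m_0`.

Write a residue as `v = b (n + 2) + t` with `t < n + 2`. Its cheapest representation by excesses
uses `max b ⌈(b + t) / 2⌉` summands (`minLength`), and this is at most `n` for every `v < m_0`.
Since `m_0` has excess 0, shorter representations can be padded. So `x ∈ Γ` iff `minLength (x % m_0)
≤ x / m_0` (`mem_S5_iff`), `ord x = x / m_0` on `Γ` (`ord_eq_div`), and `Ap` consists of the numbers
`minLength v * m_0 + v` (`mul_add_mem_aperySet_iff`).

Homogeneity and the orders follow at once. Moreover `sM` is the part of `Γ` from `s m_0` on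
(`mem_nfold_iff`), which gives the reduction number and all table entries. Counting by order means
counting pairs `(b, t)`. The blocks sort these pairs by parity and by comparison of `t` with `b`
(`exists_column`); a count of columns shows that none is repeated. -/

/-! ### Generators and factorizations -/

theorem gen5_zero (n : ℕ) : gen5 n 0 = n ^ 2 + 3 * n + 1 := by simp [gen5_eq]

theorem gen5_one (n : ℕ) : gen5 n 1 = gen5 n 0 + 1 := by simp [gen5_eq]

theorem gen5_two (n : ℕ) : gen5 n 2 = gen5 n 0 + 2 := by simp [gen5_eq]

theorem gen5_three (n : ℕ) : gen5 n 3 = gen5 n 0 + (n + 2) := by simp [gen5_eq]; ring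

theorem gen5_four (n : ℕ) : gen5 n 4 = gen5 n 0 + (n + 3) := by simp [gen5_eq]; ring

theorem gen5_zero_pos (n : ℕ) : 0 < gen5 n 0 := by simp [gen5_zero]

theorem mem_S5_iff_factorizations (n x : ℕ) :
    x ∈ S5 n ↔ (factorizations (gen5 n) x).Nonempty := by
  constructor
  · intro hx
    induction hx using AddSubmonoid.closure_induction with
    | mem x hx =>
      obtain ⟨i, rfl⟩ := hx
      exact ⟨Pi.single i 1, by simp [factorizations, Pi.single_apply]⟩
    | zero => exact ⟨0, by simp [factorizations]⟩
    | add x y _ _ hx hy =>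
      obtain ⟨c, hc⟩ := hx
      obtain ⟨d, hd⟩ := hy
      refine ⟨c + d, ?_⟩
      simp only [factorizations, Set.mem_ofPred_eq] at hc hd ⊢
      simp [add_mul, Finset.sum_add_distrib, hc, hd]
  · rintro ⟨c, rfl⟩
    refine AddSubmonoid.sum_mem _ fun i _ => ?_
    rw [← smul_eq_mul]
    exact AddSubmonoid.nsmul_mem _ (AddSubmonoid.subset_closure (Set.mem_range_self i)) _

/-! ### Minimal lengths of residues modulo `m_0` -/

/-- The least number of summands from `{1, 2, n + 2, n + 3}` with sum `v`, for `v < m_0`. -/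
def minLength (n v : ℕ) : ℕ := max (v / (n + 2)) ((v / (n + 2) + v % (n + 2) + 1) / 2)

theorem minLength_mul_add (n b t : ℕ) (ht : t < n + 2) :
    minLength n (b * (n + 2) + t) = max b ((b + t + 1) / 2) := by
  have h1 : (b * (n + 2) + t) / (n + 2) = b := by
    rw [mul_comm, Nat.mul_add_div (by omega), Nat.div_eq_of_lt ht, add_zero]
  have h2 : (b * (n + 2) + t) % (n + 2) = t := by
    rw [mul_comm, Nat.mul_add_mod, Nat.mod_eq_of_lt ht]
  rw [minLength, h1, h2]

/-- Since `m_0 = n (n + 2) + (n + 1)`, the comparison is lexicographic. The truncated `t - n` is 1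
only for `t = n + 1`, which rules out `b = n`. -/
theorem mul_add_lt_gen5_zero_iff (n b t : ℕ) (ht : t < n + 2) :
    b * (n + 2) + t < gen5 n 0 ↔ b + (t - n) ≤ n := by
  rw [gen5_zero]
  constructor
  · intro h
    by_contra hc
    rcases Nat.lt_or_ge n b with hb | hb
    · nlinarith
    · have : b = n := by omega
      subst this
      nlinarith [show b < t by omega]
  · intro h
    rcases Nat.lt_or_ge b n with hb | hb
    · obtain ⟨d, rfl⟩ := Nat.exists_eq_add_of_lt hb
      nlinarith
    · have : b = n := by omega
      subst this
      nlinarith [show t ≤ b by omega]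

theorem exists_eq_mul_add (n v : ℕ) (hv : v < gen5 n 0) :
    ∃ b t, t < n + 2 ∧ b + (t - n) ≤ n ∧ v = b * (n + 2) + t := by
  have ht : v % (n + 2) < n + 2 := Nat.mod_lt _ (by omega)
  have hv' : v = v / (n + 2) * (n + 2) + v % (n + 2) := (Nat.div_add_mod' v (n + 2)).symm
  exact ⟨_, _, ht, (mul_add_lt_gen5_zero_iff n _ _ ht).1 (hv' ▸ hv), hv'⟩

theorem minLength_le (n v : ℕ) (hv : v < gen5 n 0) : minLength n v ≤ n := by
  obtain ⟨b, t, ht, hb, rfl⟩ := exists_eq_mul_add n v hv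
  rw [minLength_mul_add n b t ht]
  omega

/-- A factorization of length `l` has excess at most `l (n + 3)` over `l m_0`. -/
theorem exists_excess (n : ℕ) (c : Fin 5 → ℕ) :
    ∃ v, ∑ i, c i * gen5 n i = (∑ i, c i) * gen5 n 0 + v ∧ v ≤ (∑ i, c i) * (n + 3) ∧
      (∑ i, c i ≤ n → minLength n v ≤ ∑ i, c i) := by
  refine ⟨(c 3 + c 4) * (n + 2) + (c 1 + 2 * c 2 + c 4), ?_, ?_, ?_⟩
  · simp only [Fin.sum_univ_five, gen5_one, gen5_two, gen5_three, gen5_four]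
    ring
  · simp only [Fin.sum_univ_five]
    nlinarith [Nat.zero_le (c 0 * n), Nat.zero_le (c 1 * n), Nat.zero_le (c 2 * n)]
  · simp only [Fin.sum_univ_five]
    intro hn
    rcases Nat.lt_or_ge (c 1 + 2 * c 2 + c 4) (n + 2) with ht | ht
    · rw [minLength_mul_add n _ _ ht]
      omega
    -- The low part overflows `n + 2`. As it is at most `2 n`, one carry suffices.
    · obtain ⟨t, ht⟩ := Nat.exists_eq_add_of_le ht
      rw [show (c 3 + c 4) * (n + 2) + (c 1 + 2 * c 2 + c 4)
          = (c 3 + c 4 + 1) * (n + 2) + t by rw [ht]; ring,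
        minLength_mul_add n _ _ (by omega)]
      omega

/-! ### Membership, lengths and orders by division -/

theorem sum_le_div (n x : ℕ) {c : Fin 5 → ℕ} (hc : c ∈ factorizations (gen5 n) x) :
    ∑ i, c i ≤ x / gen5 n 0 := by
  obtain ⟨v, hv, -⟩ := exists_excess n c
  have hc : ∑ i, c i * gen5 n i = x := hc
  rw [Nat.le_div_iff_mul_le (gen5_zero_pos n)]
  omega

/-- The excess is at most `n (n + 3) = m_0 - 1`, so it never spills into the quotient. -/
theorem div_mod_eq_of_sum_le (n : ℕ) {c : Fin 5 → ℕ} (hn : ∑ i, c i ≤ n) :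
    (∑ i, c i * gen5 n i) / gen5 n 0 = ∑ i, c i ∧
      minLength n ((∑ i, c i * gen5 n i) % gen5 n 0) ≤ ∑ i, c i := by
  obtain ⟨v, hv, hv', hmin⟩ := exists_excess n c
  have hlt : v < gen5 n 0 := by rw [gen5_zero]; nlinarith
  rw [hv, mul_comm _ (gen5 n 0), Nat.mul_add_div (gen5_zero_pos n), Nat.mul_add_mod,
    Nat.div_eq_of_lt hlt, Nat.mod_eq_of_lt hlt]
  exact ⟨rfl, hmin hn⟩

theorem exists_factorization (n l v : ℕ) (hv : v < gen5 n 0) (hl : minLength n v ≤ l) :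
    ∃ c : Fin 5 → ℕ, ∑ i, c i = l ∧ ∑ i, c i * gen5 n i = l * gen5 n 0 + v := by
  obtain ⟨b, t, ht, hb, rfl⟩ := exists_eq_mul_add n v hv
  rw [minLength_mul_add n b t ht] at hl
  obtain ⟨c, hc0, hc1⟩ : ∃ c : Fin 5 → ℕ, ∑ i, c i = l ∧ c 3 + c 4 = b ∧
      c 1 + 2 * c 2 + c 4 = t := by
    -- Use `b` generators from `m_3, m_4`, with as many `m_4` as `t` allows; the rest of `t` is made
    -- of 2's and at most one 1, and copies of `m_0` pad the length to `l`.
    refine ⟨![l - b - (t - min t b) / 2 - (t - min t b) % 2, (t - min t b) % 2,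
      (t - min t b) / 2, b - min t b, min t b], ?_, ?_, ?_⟩
    · simp [Fin.sum_univ_five]; omega
    · simp
    · simp; omega
  refine ⟨c, hc0, ?_⟩
  rw [← hc0, ← hc1.1, ← hc1.2]
  simp only [Fin.sum_univ_five, gen5_one, gen5_two, gen5_three, gen5_four]
  ring

theorem mem_S5_iff (n x : ℕ) : x ∈ S5 n ↔ minLength n (x % gen5 n 0) ≤ x / gen5 n 0 := by
  have hlt : x % gen5 n 0 < gen5 n 0 := Nat.mod_lt _ (gen5_zero_pos n)
  rw [mem_S5_iff_factorizations]
  constructor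
  · rintro ⟨c, hc⟩
    -- A quotient above `n` satisfies the bound for any residue; otherwise every factorization has
    -- length at most `n`.
    rcases Nat.lt_or_ge n (x / gen5 n 0) with h | h
    · exact (minLength_le n _ hlt).trans h.le
    · have hle := sum_le_div n x hc
      obtain ⟨h1, h2⟩ := div_mod_eq_of_sum_le n (hle.trans h)
      have hc : ∑ i, c i * gen5 n i = x := hc
      rw [hc] at h1 h2
      exact h2.trans hle
  · intro h
    obtain ⟨c, -, hc⟩ := exists_factorization n _ _ hlt h
    exact ⟨c, hc.trans (Nat.div_add_mod' x _)⟩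

theorem mul_add_mem_S5_iff (n l v : ℕ) (hv : v < gen5 n 0) :
    l * gen5 n 0 + v ∈ S5 n ↔ minLength n v ≤ l := by
  rw [mem_S5_iff, mul_comm, Nat.mul_add_mod, Nat.mod_eq_of_lt hv,
    Nat.mul_add_div (gen5_zero_pos n), Nat.div_eq_of_lt hv, add_zero]

theorem div_mem_lengthSet (n x : ℕ) (hx : x ∈ S5 n) :
    x / gen5 n 0 ∈ lengthSet (gen5 n) x := by
  obtain ⟨c, hc, hc'⟩ := exists_factorization n _ _ (Nat.mod_lt _ (gen5_zero_pos n))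
    ((mem_S5_iff n x).1 hx)
  exact ⟨c, hc'.trans (Nat.div_add_mod' x _), hc⟩

theorem ord_eq_div (n x : ℕ) (hx : x ∈ S5 n) : ord (gen5 n) x = x / gen5 n 0 := by
  have : IsGreatest (lengthSet (gen5 n) x) (x / gen5 n 0) := by
    refine ⟨div_mem_lengthSet n x hx, ?_⟩
    rintro _ ⟨c, hc, rfl⟩
    exact sum_le_div n x hc
  exact this.csSup_eq

/-- Copies of `m_0` carry no excess, so only the other coefficients have to sum to at most `n`. -/
theorem ord_eq_of_sum (n c₀ c₁ c₂ c₃ c₄ : ℕ) {x l : ℕ} (hc : c₁ + c₂ + c₃ + c₄ ≤ n)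
    (hx : c₀ * gen5 n 0 + c₁ * gen5 n 1 + c₂ * gen5 n 2 + c₃ * gen5 n 3 + c₄ * gen5 n 4 = x)
    (hl : c₀ + c₁ + c₂ + c₃ + c₄ = l) : ord (gen5 n) x = l := by
  have hxS : x ∈ S5 n := (mem_S5_iff_factorizations n x).2
    ⟨![c₀, c₁, c₂, c₃, c₄], by simpa [factorizations, Fin.sum_univ_five] using hx⟩
  have hlt : (c₃ + c₄) * (n + 2) + (c₁ + 2 * c₂ + c₄) < gen5 n 0 := by
    rw [gen5_zero]
    nlinarith [Nat.zero_le (c₁ * n), Nat.zero_le (c₂ * n)]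
  have hxl : x = gen5 n 0 * l + ((c₃ + c₄) * (n + 2) + (c₁ + 2 * c₂ + c₄)) := by
    rw [← hx, ← hl, gen5_one, gen5_two, gen5_three, gen5_four]
    ring
  rw [ord_eq_div n x hxS, hxl, Nat.mul_add_div (gen5_zero_pos n), Nat.div_eq_of_lt hlt, add_zero]

/-! ### The Apéry set -/

/-- Subtracting `m_0` keeps the residue and lowers the quotient by one, so Apéry elements have the
least admissible quotient. -/
theorem mul_add_mem_aperySet_iff (n l v : ℕ) (hv : v < gen5 n 0) :
    l * gen5 n 0 + v ∈ aperySet (S5 n) (gen5 n 0) ↔ minLength n v = l := by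
  constructor
  · rintro ⟨h1, h2⟩
    rw [mul_add_mem_S5_iff n l v hv] at h1
    refine h1.antisymm ?_
    by_contra hlt
    refine h2 ⟨(l - 1) * gen5 n 0 + v, (mul_add_mem_S5_iff n _ v hv).2 (by omega), ?_⟩
    obtain ⟨k, rfl⟩ : ∃ k, l = k + 1 := ⟨l - 1, by omega⟩
    simp only [Nat.add_sub_cancel]
    ring
  · intro h
    refine ⟨(mul_add_mem_S5_iff n l v hv).2 h.le, ?_⟩
    rintro ⟨t, ht, hts⟩
    rw [mem_S5_iff] at ht
    have h1 : t % gen5 n 0 = v := by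
      have := congrArg (· % gen5 n 0) hts
      simpa [mul_comm l, Nat.mul_add_mod, Nat.mod_eq_of_lt hv] using this
    have h2 : t / gen5 n 0 + 1 = l := by
      have := congrArg (· / gen5 n 0) hts
      simpa [mul_comm l, Nat.mul_add_div (gen5_zero_pos n), Nat.div_eq_of_lt hv,
        Nat.add_div_right _ (gen5_zero_pos n)] using this
    rw [h1] at ht
    omega

theorem exists_eq_of_mem_aperySet (n x : ℕ) (hx : x ∈ aperySet (S5 n) (gen5 n 0)) :
    ∃ v, v < gen5 n 0 ∧ x = minLength n v * gen5 n 0 + v := by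
  have hlt : x % gen5 n 0 < gen5 n 0 := Nat.mod_lt _ (gen5_zero_pos n)
  have h := Nat.div_add_mod' x (gen5 n 0)
  rw [← h, mul_add_mem_aperySet_iff n _ _ hlt] at hx
  exact ⟨_, hlt, by rw [hx, h]⟩

theorem isHomogeneous_aperySet (n : ℕ) :
    IsHomogeneous (gen5 n) (aperySet (S5 n) (gen5 n 0)) := by
  intro x hx _
  have hS : x ∈ S5 n := hx.1
  obtain ⟨v, hv, hxv⟩ := exists_eq_of_mem_aperySet n x hx
  refine ⟨x / gen5 n 0, Set.eq_singleton_iff_unique_mem.2 ⟨div_mem_lengthSet n x hS, ?_⟩⟩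
  rintro _ ⟨c, hc, rfl⟩
  have hle := sum_le_div n x hc
  have hxn : x / gen5 n 0 ≤ n := by
    rw [hxv, mul_comm, Nat.mul_add_div (gen5_zero_pos n), Nat.div_eq_of_lt hv, add_zero]
    exact minLength_le n v hv
  have h1 := (div_mod_eq_of_sum_le n (hle.trans hxn)).1
  have hc : ∑ i, c i * gen5 n i = x := hc
  rw [hc] at h1
  exact h1.symm

theorem ord_add_mul (n k w : ℕ) (hw : w ∈ S5 n) :
    ord (gen5 n) (w + k * gen5 n 0) = ord (gen5 n) w + k := by
  have h0 : gen5 n 0 ∈ S5 n := AddSubmonoid.subset_closure ⟨0, rfl⟩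
  rw [ord_eq_div n _ (add_mem hw (by rw [← smul_eq_mul]; exact nsmul_mem h0 k)),
    ord_eq_div n _ hw, Nat.add_mul_div_right _ _ (gen5_zero_pos n)]

/-! ### Multiples of `M`, reduction number and table entries -/

/-- Nonzero elements of `Γ` are at least `m_0`. Conversely, an `x ≥ s m_0` in `Γ` has a
factorization of length `x / m_0 ≥ s`, from which generators can be split off one by one. -/
theorem mem_nfold_iff (n s x : ℕ) :
    x ∈ nfold (S5 n) s ↔ x ∈ S5 n ∧ s * gen5 n 0 ≤ x := by
  induction s generalizing x with
  | zero => simp [nfold]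
  | succ s ih =>
    have hpos := gen5_zero_pos n
    constructor
    · rintro ⟨y, hy, z, hz, hz0, rfl⟩
      rw [ih] at hy
      refine ⟨add_mem hy.1 hz, ?_⟩
      have hge : gen5 n 0 ≤ z := by
        by_contra hlt
        push Not at hlt
        have h := (mem_S5_iff n z).1 hz
        rw [Nat.mod_eq_of_lt hlt, Nat.div_eq_of_lt hlt] at h
        obtain ⟨b, t, ht, hb, rfl⟩ := exists_eq_mul_add n z hlt
        rw [minLength_mul_add n b t ht] at h
        obtain rfl : b = 0 := by omega
        omega
      rw [add_mul]
      omega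
    · rintro ⟨hx, hle⟩
      obtain ⟨c, hc, hcs⟩ := div_mem_lengthSet n x hx
      have hc : ∑ i, c i * gen5 n i = x := hc
      have hs : s + 1 ≤ ∑ i, c i := by
        rw [← Nat.le_div_iff_mul_le hpos] at hle
        exact hle.trans hcs.ge
      obtain ⟨i, hi⟩ : ∃ i, c i ≠ 0 := by
        by_contra h
        push Not at h
        simp [h] at hs
      have hgi : gen5 n i ∈ S5 n := AddSubmonoid.subset_closure ⟨i, rfl⟩
      have hge0 : gen5 n 0 ≤ gen5 n i := by
        fin_cases i <;> simp [gen5_one, gen5_two, gen5_three, gen5_four]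
      obtain ⟨d, rfl⟩ : ∃ d : Fin 5 → ℕ, c = d + Pi.single i 1 := by
        refine ⟨c - Pi.single i 1, funext fun j => ?_⟩
        by_cases hj : j = i
        · subst hj; simp; omega
        · simp [hj]
      have hsplit : ∀ f : Fin 5 → ℕ, ∑ j, (d + Pi.single i 1 : Fin 5 → ℕ) j * f j
          = ∑ j, d j * f j + f i := by
        intro f
        simp [add_mul, Finset.sum_add_distrib, Pi.single_apply]
      refine ⟨∑ j, d j * gen5 n j, ?_, gen5 n i, hgi, by omega, ?_⟩
      · rw [ih]
        refine ⟨(mem_S5_iff_factorizations n _).2 ⟨_, rfl⟩, ?_⟩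
        have h1 := hsplit 1
        simp only [Pi.one_apply, mul_one] at h1
        obtain ⟨v, hv, -⟩ := exists_excess n d
        have : s * gen5 n 0 ≤ (∑ j, d j) * gen5 n 0 :=
          Nat.mul_le_mul_right _ (by omega)
        omega
      · rw [← hc, hsplit (gen5 n)]

/-- Apéry elements lie below `(n + 1) m_0`, so `m_0` can be subtracted throughout `(n + 1)M`. No
smaller index works, because `n m_4` is an Apéry element of order `n`. -/
theorem reductionNumber_S5 (n : ℕ) : reductionNumber (S5 n) (gen5 n 0) = n := by
  have hlt : n * (n + 3) < gen5 n 0 := by rw [gen5_zero]; nlinarith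
  have hmin : minLength n (n * (n + 3)) = n := by
    rw [show n * (n + 3) = n * (n + 2) + n by ring, minLength_mul_add n n n (by omega)]
    omega
  have hAp : n * gen5 n 0 + n * (n + 3) ∈ aperySet (S5 n) (gen5 n 0) :=
    (mul_add_mem_aperySet_iff n _ _ hlt).2 hmin
  refine IsLeast.csInf_eq ⟨?_, ?_⟩
  · ext x
    simp only [Set.mem_image, mem_nfold_iff]
    constructor
    · rintro ⟨hx, hle⟩
      by_cases hxA : x ∈ aperySet (S5 n) (gen5 n 0)
      · obtain ⟨v, hv, rfl⟩ := exists_eq_of_mem_aperySet n x hxA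
        have := Nat.mul_le_mul_right (gen5 n 0) (minLength_le n v hv)
        rw [add_mul] at hle
        omega
      · simp only [aperySet, Set.mem_ofPred_eq, not_and, not_not] at hxA
        obtain ⟨t, ht, rfl⟩ := hxA hx
        rw [add_mul] at hle
        exact ⟨t, ⟨ht, by omega⟩, add_comm _ _⟩
    · rintro ⟨t, ⟨ht, hle⟩, rfl⟩
      refine ⟨add_mem (AddSubmonoid.subset_closure ⟨0, rfl⟩) ht, ?_⟩
      rw [add_mul]
      omega
  · intro r hr
    by_contra hrn
    have hmem : n * gen5 n 0 + n * (n + 3) ∈ nfold (S5 n) (r + 1) := by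
      rw [mem_nfold_iff]
      exact ⟨hAp.1, (Nat.mul_le_mul_right _ (by omega)).trans (Nat.le_add_right _ _)⟩
    have hr : nfold (S5 n) (r + 1) = (fun x => gen5 n 0 + x) '' nfold (S5 n) r := hr
    rw [hr] at hmem
    obtain ⟨t, ht, hts⟩ := hmem
    exact hAp.2 ⟨t, ((mem_nfold_iff n r t).1 ht).1, by rw [← hts]; exact add_comm _ _⟩

/-- An entry stays equal to `w` until the row index exceeds `ord w`, and then gains `m_0` in every
row. -/
theorem aperyEntry_eq (n v s : ℕ) (hv : v < gen5 n 0) :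
    aperyEntry (S5 n) (gen5 n 0) (minLength n v * gen5 n 0 + v) s
      = minLength n v * gen5 n 0 + v + (s - minLength n v) * gen5 n 0 := by
  have hpos := gen5_zero_pos n
  induction s using Nat.strong_induction_on with
  | _ s ih =>
  match s with
  | 0 => simp [aperyEntry]
  | 1 =>
    have hzero : minLength n v = 0 → v = 0 := by
      intro h
      obtain ⟨b, t, ht, hb, rfl⟩ := exists_eq_mul_add n v hv
      rw [minLength_mul_add n b t ht] at h
      obtain rfl : b = 0 := by omega
      omega
    have hminz : minLength n 0 = 0 := by simp [minLength]
    rw [aperyEntry]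
    by_cases h : minLength n v = 0
    · have := hzero h
      subst this
      simp [hminz]
    · have h1 : 1 - minLength n v = 0 := by omega
      have h2 : minLength n v * gen5 n 0 ≠ 0 := mul_ne_zero h hpos.ne'
      rw [if_neg (by omega), h1, zero_mul, add_zero]
  | s + 2 =>
    have hmem : ∀ l, minLength n v ≤ l →
        (l * gen5 n 0 + v ∈ nfold (S5 n) (s + 2) ↔ s + 2 ≤ l) := by
      intro l hl
      rw [mem_nfold_iff, mul_add_mem_S5_iff n l v hv]
      constructor
      · rintro ⟨-, h⟩
        by_contra hlt
        have := Nat.mul_le_mul_right (gen5 n 0) (show l + 1 ≤ s + 2 by omega)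
        rw [add_mul] at this
        omega
      · intro h
        exact ⟨hl, (Nat.mul_le_mul_right _ h).trans (Nat.le_add_right _ _)⟩
    rw [aperyEntry, ih (s + 1) (by omega)]
    have hsum : ∀ a, minLength n v * gen5 n 0 + v + a * gen5 n 0
        = (minLength n v + a) * gen5 n 0 + v := fun a => by ring
    rw [hsum, hmem _ (by omega)]
    split_ifs with h
    · rw [hsum, show s + 1 - minLength n v = s + 2 - minLength n v by omega]
    · rw [hsum, show s + 2 - minLength n v = s + 1 - minLength n v + 1 by omega]
      ring

/-! ### Counting Apéry elements by order -/

theorem ncard_ord_eq (n k : ℕ) (hk : 1 ≤ k) (hkn : k ≤ n) (hn : Even n) :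
    {w | w ∈ aperySet (S5 n) (gen5 n 0) ∧ ord (gen5 n) w = k}.ncard =
      if k ≤ n / 2 then 3 * k + 1 else 2 * n + 4 - k := by
  classical
  -- The maximum equals `k` when `b = k` and `t ≤ k`, or when `b < k` and `b + t` is `2 k` or `2 k -
  -- 1`. The lower bounds on `b` express `t ≤ n + 1`.
  let P : Finset (ℕ × ℕ) := (Finset.range (k + 1)).image (fun t => (k, t)) ∪
    ((Finset.Ico (2 * k - n - 1) k).image (fun b => (b, 2 * k - b)) ∪
      (Finset.Ico (2 * k - n - 2) k).image (fun b => (b, 2 * k - 1 - b)))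
  have hP : ∀ b t, (b, t) ∈ P ↔ t < n + 2 ∧ b + (t - n) ≤ n ∧ max b ((b + t + 1) / 2) = k := by
    intro b t
    simp only [P, Finset.mem_union, Finset.mem_image, Finset.mem_range, Finset.mem_Ico,
      Prod.mk.injEq]
    constructor
    · rintro (⟨a, h, rfl, rfl⟩ | ⟨a, h, rfl, rfl⟩ | ⟨a, h, rfl, rfl⟩) <;> omega
    · rintro ⟨h1, h2, h3⟩
      by_cases hb : b = k
      · exact Or.inl ⟨t, by omega, hb.symm, rfl⟩
      · by_cases he : b + t = 2 * k
        · exact Or.inr (Or.inl ⟨b, by omega, rfl, by omega⟩)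
        · exact Or.inr (Or.inr ⟨b, by omega, rfl, by omega⟩)
  have hcard : P.card = if k ≤ n / 2 then 3 * k + 1 else 2 * n + 4 - k := by
    rw [Finset.card_union_of_disjoint, Finset.card_union_of_disjoint,
      Finset.card_image_of_injective, Finset.card_image_of_injective,
      Finset.card_image_of_injective, Finset.card_range, Nat.card_Ico, Nat.card_Ico]
    -- Parity excludes `2 k = n + 1`, where the second formula would fail.
    · obtain ⟨h, rfl⟩ := hn
      split_ifs <;> omega
    · intro a b h; exact (Prod.mk.injEq _ _ _ _ ▸ h).1
    · intro a b h; exact (Prod.mk.injEq _ _ _ _ ▸ h).1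
    · intro a b h; exact (Prod.mk.injEq _ _ _ _ ▸ h).2
    · rw [Finset.disjoint_left]
      rintro ⟨b, t⟩ h1 h2
      simp only [Finset.mem_image, Finset.mem_Ico, Prod.mk.injEq] at h1 h2
      obtain ⟨a, ha, rfl, rfl⟩ := h1
      obtain ⟨a', ha', h, h'⟩ := h2
      omega
    · rw [Finset.disjoint_left]
      rintro ⟨b, t⟩ h1 h2
      simp only [Finset.mem_union, Finset.mem_image, Finset.mem_Ico, Finset.mem_range,
        Prod.mk.injEq] at h1 h2
      obtain ⟨a, ha, rfl, rfl⟩ := h1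
      rcases h2 with ⟨a', ha', h, h'⟩ | ⟨a', ha', h, h'⟩ <;> omega
  have hset : {w | w ∈ aperySet (S5 n) (gen5 n 0) ∧ ord (gen5 n) w = k}
      = (fun p : ℕ × ℕ => k * gen5 n 0 + (p.1 * (n + 2) + p.2)) '' (P : Set (ℕ × ℕ)) := by
    ext w
    constructor
    · rintro ⟨hw, hord⟩
      obtain ⟨v, hv, hwv⟩ := exists_eq_of_mem_aperySet n w hw
      rw [ord_eq_div n w hw.1, hwv, mul_comm, Nat.mul_add_div (gen5_zero_pos n),
        Nat.div_eq_of_lt hv, add_zero] at hord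
      obtain ⟨b, t, ht, hb, rfl⟩ := exists_eq_mul_add n v hv
      refine ⟨(b, t), ?_, ?_⟩
      · rw [minLength_mul_add n b t ht] at hord
        exact (hP b t).2 ⟨ht, hb, hord⟩
      · rw [hwv, hord]
    · rintro ⟨⟨b, t⟩, hp, rfl⟩
      obtain ⟨ht, hb, hm⟩ := (hP b t).1 hp
      have hv := (mul_add_lt_gen5_zero_iff n b t ht).2 hb
      rw [← minLength_mul_add n b t ht] at hm
      have hw := (mul_add_mem_aperySet_iff n k _ hv).2 hm
      refine ⟨hw, ?_⟩
      rw [ord_eq_div n _ hw.1]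
      rw [mul_comm, Nat.mul_add_div (gen5_zero_pos n), Nat.div_eq_of_lt hv, add_zero]
  rw [hset, Set.InjOn.ncard_image, Set.ncard_coe_finset, hcard]
  rintro ⟨b, t⟩ hp ⟨b', t'⟩ hp' heq
  have ht := ((hP b t).1 hp).1
  have ht' := ((hP b' t').1 hp').1
  have heq : b * (n + 2) + t = b' * (n + 2) + t' := by
    simp only at heq
    omega
  have h1 := congrArg (· % (n + 2)) heq
  have h2 := congrArg (· / (n + 2)) heq
  simp only [Nat.mul_add_mod', Nat.mod_eq_of_lt ht, Nat.mod_eq_of_lt ht'] at h1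
  simp only [mul_comm _ (n + 2), Nat.mul_add_div (show 0 < n + 2 by omega),
    Nat.div_eq_of_lt ht, Nat.div_eq_of_lt ht', add_zero] at h2
  rw [h1, h2]

/-! ### Columns of the table -/

/-- This and the following formulas bring each block to the shape `l m_0 + (b (n + 2) + t) + (i - l)
m_0`, with rows `i` counted from 0, `l` the order, `b` the number of `m_3` and `m_4`, and `t` the
remaining excess. -/
theorem b1_zero_eq (n i : ℕ) : b1 n (i + 1) (0 + 1) =
    0 * gen5 n 0 + (0 * (n + 2) + 0) + (i - 0) * gen5 n 0 := by
  simp [b1]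

theorem b1_one_eq (n i : ℕ) : b1 n (i + 1) (1 + 1) =
    1 * gen5 n 0 + (0 * (n + 2) + 1) + (i - 1) * gen5 n 0 := by
  have h : (if i + 1 ≤ 2 then gen5 n 1 else gen5 n 1 + (i + 1 - 2) * gen5 n 0)
      = gen5 n 1 + (i - 1) * gen5 n 0 := by
    split_ifs with h
    · simp [show i - 1 = 0 by omega]
    · rw [show i + 1 - 2 = i - 1 by omega]
  rw [b1, if_neg (by omega), h, gen5_one]
  ring

theorem b2_eq (n i j : ℕ) : b2 n (i + 1) j =
    j * gen5 n 0 + (0 * (n + 2) + 2 * j) + (i - j) * gen5 n 0 := by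
  rw [b2, show (if i + 1 > j + 1 then i + 1 - j - 1 else 0) = i - j by split_ifs <;> omega,
    gen5_two]
  ring

theorem b3_eq (n i j : ℕ) : b3 n (i + 1) j =
    j * gen5 n 0 + (j * (n + 2) + 0) + (i - j) * gen5 n 0 := by
  rw [b3, show (if i + 1 > j + 1 then i + 1 - j - 1 else 0) = i - j by split_ifs <;> omega,
    gen5_three]
  ring

theorem b4_eq (n i j : ℕ) : b4 n (i + 1) j =
    j * gen5 n 0 + (j * (n + 2) + j) + (i - j) * gen5 n 0 := by
  rw [b4, show (if i + 1 > j + 1 then i + 1 - j - 1 else 0) = i - j by split_ifs <;> omega,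
    gen5_four]
  ring

theorem b5_eq (n i j : ℕ) : b5 n (i + 1) j =
    (j + 1) * gen5 n 0 + (0 * (n + 2) + (2 * j + 1)) + (i - (j + 1)) * gen5 n 0 := by
  rw [b5, show (if i + 1 > j + 2 then i + 1 - j - 2 else 0) = i - (j + 1) by
    split_ifs <;> omega, gen5_one, gen5_two]
  ring

theorem b6_eq (n i j : ℕ) : b6 n (i + 1) j =
    (j + 1) * gen5 n 0 + (1 * (n + 2) + 2 * j) + (i - (j + 1)) * gen5 n 0 := by
  rw [b6, show (if i + 1 > j + 2 then i + 1 - j - 2 else 0) = i - (j + 1) by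
    split_ifs <;> omega, gen5_three, gen5_two]
  ring

theorem b7_eq (n s i j : ℕ) : b7 n s (i + 1) j =
    (2 * s + j) * gen5 n 0 + (2 * s * (n + 2) + (2 * s + 2 * j))
      + (i - (2 * s + j)) * gen5 n 0 := by
  rw [b7, show (if i + 1 > j + 2 * s + 1 then i + 1 - j - 2 * s - 1 else 0) = i - (2 * s + j) by
    split_ifs <;> omega, gen5_four, gen5_two]
  ring

theorem b8_eq (n s i j : ℕ) : b8 n (s + 1) (i + 1) j =
    (2 * s + 1 + j) * gen5 n 0 + ((2 * s + 1) * (n + 2) + (2 * s + 1 + 2 * j))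
      + (i - (2 * s + 1 + j)) * gen5 n 0 := by
  rw [b8, show (if i + 1 > j + 2 * (s + 1) then i + 1 - j - 2 * (s + 1) else 0)
    = i - (2 * s + 1 + j) by split_ifs <;> omega, gen5_four, gen5_two,
    show 2 * (s + 1) - 1 = 2 * s + 1 by omega]
  ring

/-- Here `a` is the multiplicity of `m_4`; naming it avoids truncated subtraction. -/
theorem b9_eq (n s i j a : ℕ) (h : a + j + s = n + 1) (ha : 1 ≤ a) : b9 n s (i + 1) j =
    (a + j) * gen5 n 0 + ((a + j) * (n + 2) + a) + (i - (a + j)) * gen5 n 0 := by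
  rw [b9, show (if i + 1 + s > n + 2 then i + 1 + s - n - 2 else 0) = i - (a + j) by
    split_ifs <;> omega, gen5_four, gen5_three, show n - s - j + 1 = a by omega]
  ring

theorem b10_eq (n s i j : ℕ) : b10 n s (i + 1) j =
    (2 * s + 1 + j) * gen5 n 0 + ((2 * s + 1) * (n + 2) + (2 * s + 2 * j))
      + (i - (2 * s + 1 + j)) * gen5 n 0 := by
  rw [b10, show (if i + 1 > j + 2 * s + 2 then i + 1 - j - 2 * s - 2 else 0)
    = i - (2 * s + 1 + j) by split_ifs <;> omega, gen5_four, gen5_two, gen5_three]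
  ring

theorem b11_eq (n s i j : ℕ) : b11 n (s + 1) (i + 1) j =
    (2 * s + 2 + j) * gen5 n 0 + ((2 * s + 2) * (n + 2) + (2 * s + 1 + 2 * j))
      + (i - (2 * s + 2 + j)) * gen5 n 0 := by
  rw [b11, show (if i + 1 > j + 2 * (s + 1) + 1 then i + 1 - j - 2 * (s + 1) - 1 else 0)
    = i - (2 * s + 2 + j) by split_ifs <;> omega, gen5_four, gen5_two, gen5_three,
    show 2 * (s + 1) - 1 = 2 * s + 1 by omega]
  ring

/-- Blocks 1, 2, 5 cover `b = 0`, block 3 covers `t = 0 < b`, block 9 `0 < t < b`, and block 4 `t =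
b > 0`. For `0 < b < t` the parities of `(b, t)` decide: (even, even) is block 7, (odd, odd) block
8, (even, odd) block 11, and (odd, even) block 6 if `b = 1`, else block 10. -/
theorem exists_column (n b t : ℕ) (hn : Even n) (ht : t < n + 2) (hb : b + (t - n) ≤ n) :
    ∃ x, ∀ i, table5 n i x = max b ((b + t + 1) / 2) * gen5 n 0 + (b * (n + 2) + t)
      + (i - max b ((b + t + 1) / 2)) * gen5 n 0 := by
  -- Freeing `l` lets each case give the order in the form used by its block formula.
  suffices h : ∃ x l, l = max b ((b + t + 1) / 2) ∧ ∀ i, table5 n i x =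
      l * gen5 n 0 + (b * (n + 2) + t) + (i - l) * gen5 n 0 by
    obtain ⟨x, l, rfl, h⟩ := h
    exact ⟨x, h⟩
  obtain ⟨h, hh⟩ := hn
  rcases Nat.eq_zero_or_pos b with rfl | hb0
  · obtain ⟨j, rfl | rfl⟩ := Nat.even_or_odd' t
    · rcases j with _ | j
      · exact ⟨.inl 0, _, by simp, fun i => b1_zero_eq n i⟩
      · exact ⟨.inr <| .inl ⟨j, by omega⟩, j + 1, by omega, fun i => b2_eq n i (j + 1)⟩
    · rcases j with _ | j
      · exact ⟨.inl 1, 1, by simp, fun i => b1_one_eq n i⟩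
      · exact ⟨.inr <| .inr <| .inr <| .inr <| .inl ⟨j, by omega⟩, j + 1 + 1, by omega,
          fun i => b5_eq n i (j + 1)⟩
  rcases Nat.eq_zero_or_pos t with rfl | ht0
  · obtain ⟨j, rfl⟩ := Nat.exists_eq_add_of_lt hb0
    exact ⟨.inr <| .inr <| .inl ⟨j, by omega⟩, j + 1, by omega,
      fun i => by rw [zero_add]; exact b3_eq n i (j + 1)⟩
  rcases lt_trichotomy t b with htb | rfl | htb
  · obtain ⟨j, rfl⟩ := Nat.exists_eq_add_of_lt htb
    refine ⟨.inr <| .inr <| .inr <| .inr <| .inr <| .inr <| .inr <| .inr <| .inl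
      ⟨⟨n - (t + j + 1), by omega⟩, ⟨j, by simp; omega⟩⟩, t + (j + 1), by omega,
      fun i => b9_eq n (n - (t + j + 1) + 1) i (j + 1) t (by omega) ht0⟩
  · obtain ⟨j, rfl⟩ := Nat.exists_eq_add_of_lt hb0
    exact ⟨.inr <| .inr <| .inr <| .inl ⟨j, by omega⟩, j + 1, by omega,
      fun i => by rw [zero_add]; exact b4_eq n i (j + 1)⟩
  obtain ⟨s, rfl | rfl⟩ := Nat.even_or_odd' b
  · obtain ⟨s, rfl⟩ : ∃ s', s = s' + 1 := ⟨s - 1, by omega⟩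
    obtain ⟨d, rfl⟩ := Nat.exists_eq_add_of_lt htb
    obtain ⟨j, rfl | rfl⟩ := Nat.even_or_odd' d
    · exact ⟨.inr <| .inr <| .inr <| .inr <| .inr <| .inr <| .inr <| .inr <| .inr <| .inr
        ⟨⟨s, by omega⟩, ⟨j, by simp; omega⟩⟩, 2 * s + 2 + (j + 1), by omega,
        fun i => by
          rw [show 2 * (s + 1) + 2 * j + 1 = 2 * s + 1 + 2 * (j + 1) by ring]
          exact b11_eq n s i (j + 1)⟩
    · exact ⟨.inr <| .inr <| .inr <| .inr <| .inr <| .inr <| .inl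
        ⟨⟨s, by omega⟩, ⟨j, by simp; omega⟩⟩, 2 * (s + 1) + (j + 1), by omega,
        fun i => b7_eq n (s + 1) i (j + 1)⟩
  · obtain ⟨d, rfl⟩ := Nat.exists_eq_add_of_lt htb
    obtain ⟨j, rfl | rfl⟩ := Nat.even_or_odd' d
    · rcases s with _ | s
      · exact ⟨.inr <| .inr <| .inr <| .inr <| .inr <| .inl ⟨j, by omega⟩, j + 1 + 1, by omega,
          fun i => by
            rw [show 2 * 0 + 1 + 2 * j + 1 = 2 * (j + 1) by ring]
            exact b6_eq n i (j + 1)⟩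
      · exact ⟨.inr <| .inr <| .inr <| .inr <| .inr <| .inr <| .inr <| .inr <| .inr <| .inl
          ⟨⟨s, by omega⟩, ⟨j, by simp; omega⟩⟩, 2 * (s + 1) + 1 + (j + 1), by omega,
          fun i => by
            rw [show 2 * (s + 1) + 1 + 2 * j + 1 = 2 * (s + 1) + 2 * (j + 1) by ring]
            exact b10_eq n (s + 1) i (j + 1)⟩
    · exact ⟨.inr <| .inr <| .inr <| .inr <| .inr <| .inr <| .inr <| .inl
        ⟨⟨s, by omega⟩, ⟨j, by simp; omega⟩⟩, 2 * s + 1 + (j + 1), by omega,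
        fun i => b8_eq n s i (j + 1)⟩

/-! ### Number of columns and the Apéry table -/

theorem two_mul_sum_range_sub (N a : ℕ) :
    2 * ∑ s ∈ Finset.range N, (N + a - s) = N * (N + 2 * a + 1) := by
  induction N with
  | zero => simp
  | succ N ih =>
    have h : ∑ s ∈ Finset.range N, (N + 1 + a - (s + 1)) = ∑ s ∈ Finset.range N, (N + a - s) :=
      Finset.sum_congr rfl fun s _ => by omega
    rw [Finset.sum_range_succ', h, mul_add, ih]
    simp
    ring

/-- Sub-block widths decrease by one from `m - 1` down to `a + 1`; doubling the sum avoids division.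
-/
theorem sum_fin_sub_succ (N a m : ℕ) (h : m = N + a + 1) :
    2 * ∑ s : Fin N, (m - ((s : ℕ) + 1)) = N * (N + 2 * a + 1) := by
  rw [← two_mul_sum_range_sub, Fin.sum_univ_eq_sum_range (fun s => m - (s + 1)) N]
  congr 1
  exact Finset.sum_congr rfl fun s _ => by omega

theorem exists_column_of_lt (n v : ℕ) (hn : Even n) (hv : v < gen5 n 0) :
    ∃ x, ∀ i, table5 n i x =
      minLength n v * gen5 n 0 + v + (i - minLength n v) * gen5 n 0 := by
  obtain ⟨b, t, ht, hb, rfl⟩ := exists_eq_mul_add n v hv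
  rw [minLength_mul_add n b t ht]
  exact exists_column n b t hn ht hb

theorem isAperyTable_table5 (n : ℕ) (hn : Even n) (hn0 : 0 < n) :
    IsAperyTable (S5 n) (gen5 n 0) (table5 n) := by
  refine ⟨by rw [reductionNumber_S5], ?_⟩
  -- The column count comes last but is used first: residues inject into columns by their top
  -- entries, so equal cardinality makes this assignment bijective.
  refine and_iff_left_of_imp (fun hcard => ?_) |>.2 ?_
  · choose g hg using fun v : Fin (gen5 n 0) => exists_column_of_lt n v hn v.2
    have hrow : ∀ v, table5 n 0 (g v) = minLength n v * gen5 n 0 + v := fun v => by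
      simp [hg v 0]
    have hinj : Function.Injective fun v => table5 n 0 (g v) := by
      intro v w hvw
      simp only [hrow] at hvw
      have := congrArg (· % gen5 n 0) hvw
      simp only [Nat.mul_add_mod', Nat.mod_eq_of_lt v.2, Nat.mod_eq_of_lt w.2] at this
      exact Fin.ext this
    have hbij : Function.Bijective g :=
      (Fintype.bijective_iff_injective_and_card g).2
        ⟨hinj.of_comp (f := table5 n 0), by rw [hcard, Fintype.card_fin]⟩
    refine ⟨table5 n 0, ?_, ?_, ?_⟩
    · intro x y hxy
      obtain ⟨v, rfl⟩ := hbij.2 x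
      obtain ⟨w, rfl⟩ := hbij.2 y
      rw [hinj hxy]
    · ext w
      constructor
      · rintro ⟨x, rfl⟩
        obtain ⟨v, rfl⟩ := hbij.2 x
        rw [hrow]
        exact (mul_add_mem_aperySet_iff n _ _ v.2).2 rfl
      · intro hw
        obtain ⟨v, hv, rfl⟩ := exists_eq_of_mem_aperySet n w hw
        exact ⟨g ⟨v, hv⟩, hrow ⟨v, hv⟩⟩
    · intro i x
      obtain ⟨v, rfl⟩ := hbij.2 x
      rw [hrow, hg, aperyEntry_eq n v i v.2]
  · obtain ⟨k, hk⟩ : ∃ k, n / 2 = k + 1 := ⟨n / 2 - 1, by obtain ⟨h, rfl⟩ := hn; omega⟩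
    have hnk : n = 2 * k + 2 := by obtain ⟨h, rfl⟩ := hn; omega
    have h7 := sum_fin_sub_succ (n / 2 - 1) 0 (n / 2) (by omega)
    have h8 := sum_fin_sub_succ (n / 2) 0 (n / 2 + 1) rfl
    have h9 := sum_fin_sub_succ (n - 1) 0 n (by omega)
    have h11 := sum_fin_sub_succ (n / 2 - 1) 1 (n / 2 + 1) (by omega)
    simp only [Fintype.card_sum, Fintype.card_sigma, Fintype.card_fin, gen5_zero]
    -- Blocks 7 and 10 have the same widths, so `x7` stands for both.
    generalize ∑ s : Fin (n / 2 - 1), (n / 2 - ((s : ℕ) + 1)) = x7 at *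
    generalize ∑ s : Fin (n / 2), (n / 2 + 1 - ((s : ℕ) + 1)) = x8 at *
    generalize ∑ s : Fin (n - 1), (n - ((s : ℕ) + 1)) = x9 at *
    generalize ∑ s : Fin (n / 2 - 1), (n / 2 + 1 - ((s : ℕ) + 1)) = x11 at *
    rw [show n / 2 - 1 = k by omega] at h7 h11
    rw [hk] at h8 ⊢
    rw [show n - 1 = 2 * k + 1 by omega] at h9
    subst hnk
    nlinarith

end ConcatSemigroup

open ConcatSemigroup
theorem mainTheorem11 (q n : ℕ) (hq : 2 ≤ q) (hn : n = (5 - 1) + q * (5 - 3)) :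
    -- the Apéry set is homogeneous
    IsHomogeneous (gen5 n) (aperySet (S5 n) (gen5 n 0)) ∧
    -- orders of the translates by multiples of `m_0`
    (∀ k : ℕ, 1 ≤ k →
      ord (gen5 n) (gen5 n 1 + k * gen5 n 0) = k + 1 ∧
      (∀ r, 1 ≤ r → r ≤ n / 2 → ord (gen5 n) (r * gen5 n 2 + k * gen5 n 0) = r + k) ∧
      (∀ r, 1 ≤ r → r ≤ n →
        ord (gen5 n) (r * gen5 n 3 + k * gen5 n 0) = r + k ∧
        ord (gen5 n) (r * gen5 n 4 + k * gen5 n 0) = r + k) ∧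
      (∀ r, 1 ≤ r → r ≤ n / 2 →
        ord (gen5 n) (gen5 n 1 + r * gen5 n 3 + k * gen5 n 0) = r + k + 1 ∧
        ord (gen5 n) (gen5 n 3 + r * gen5 n 3 + k * gen5 n 0) = r + k + 1 ∧
        ord (gen5 n) (gen5 n 1 + r * gen5 n 2 + k * gen5 n 0) = r + k + 1 ∧
        ord (gen5 n) (gen5 n 3 + r * gen5 n 2 + k * gen5 n 0) = r + k + 1) ∧
      (∀ r s, 1 ≤ r → r ≤ n - 1 → 1 ≤ s → s ≤ n - r →
        ord (gen5 n) (r * gen5 n 2 + s * gen5 n 3 + k * gen5 n 0) = r + k + s ∧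
        ord (gen5 n) (r * gen5 n 3 + s * gen5 n 4 + k * gen5 n 0) = r + k + s) ∧
      (∀ w ∈ aperySet (S5 n) (gen5 n 0),
        ord (gen5 n) (w + k * gen5 n 0) = ord (gen5 n) w + k)) ∧
    -- the Apéry table, of size `(n + 1) × m_0`
    IsAperyTable (S5 n) (gen5 n 0) (table5 n) ∧
    -- the number of elements of each order in the Apéry set
    (∀ k : ℕ, 1 ≤ k → k ≤ n →
      {w | w ∈ aperySet (S5 n) (gen5 n 0) ∧ ord (gen5 n) w = k}.ncard =
        if k ≤ n / 2 then 3 * k + 1 else 2 * n + 4 - k) := by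
  have he : Even n := ⟨2 + q, by omega⟩
  refine ⟨isHomogeneous_aperySet n, fun k _ => ⟨?_, ?_, ?_, ?_, ?_, ?_⟩,
    isAperyTable_table5 n he (by omega), fun k hk hkn => ncard_ord_eq n k hk hkn he⟩
  · exact ord_eq_of_sum n k 1 0 0 0 (by omega) (by ring) (by omega)
  · intro r _ hr
    exact ord_eq_of_sum n k 0 r 0 0 (by omega) (by ring) (by omega)
  · intro r _ hr
    exact ⟨ord_eq_of_sum n k 0 0 r 0 (by omega) (by ring) (by omega),
      ord_eq_of_sum n k 0 0 0 r (by omega) (by ring) (by omega)⟩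
  · intro r _ hr
    exact ⟨ord_eq_of_sum n k 1 0 r 0 (by omega) (by ring) (by omega),
      ord_eq_of_sum n k 0 0 (r + 1) 0 (by omega) (by ring) (by omega),
      ord_eq_of_sum n k 1 r 0 0 (by omega) (by ring) (by omega),
      ord_eq_of_sum n k 0 r 1 0 (by omega) (by ring) (by omega)⟩
  · intro r s _ hr _ hs
    exact ⟨ord_eq_of_sum n k 0 r s 0 (by omega) (by ring) (by omega),
      ord_eq_of_sum n k 0 0 r s (by omega) (by ring) (by omega)⟩
  · exact fun w hw => ord_add_mul n k w hw.1
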